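/- Let $(V,Y,\mathbf 1,\omega)$ be a simple vertex operator algebra over $\mathbb{C}$, with weight decomposition $V=\bigoplus_{n\in\mathbb{Z}}V_n$, where $\dim V_n<\infty$ and $V_n=0$ for $n\ll 0$. A weak $V$-module is a complex vector space $M$ with a linear map $Y_M\colon V\to(\operatorname{End}M)[[z,z^{-1}]]$, $v\mapsto Y_M(v,z)=\sum_{n\in\mathbb{Z}}v_nz^{-n-1}$, such that for all $v\in V$ and $w\in M$ one has $v_nw=0$ for all sufficiently large $n$, such that $Y_M(\mathbf 1,z)=\mathrm{id}_M$, and such that the Jacobi identity holds; write $Y_M(\omega,z)=\sum_{n\in\mathbb{Z}}L(n)z^{-n-2}$. A weak $V$-module $M$ is called $\mathbb{Z}$-graded if it admits a decomposition $M=\bigoplus_{i\in\mathbb{Z}}M(i)$ with $v_rM(m)\subseteq M(m+n-r-1)$ for all $r,m,n\in\mathbb{Z}$ and $v\in V_n$. A weak $V$-module is irreducible if it is nonzero and has no weak submodules other than $0$ and itself, and it is completely reducible if it is a direct sum of irreducible weak submodules (which are not required to be graded). Suppose that every $\mathbb{Z}$-graded weak $V$-module is completely reducible. Then $L(0)$ acts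 semisimply on every irreducible weak $V$-module $W$, that is, $W$ is the direct sum of the eigenspaces of $L(0)$. In particular, every irreducible weak $V$-module is $\mathbb{Z}$-graded. -/

import Mathlib

universe u v

/-- The Jacobi identity for a field map `YM : V → (End M)[[z, z⁻¹]]` relative to
`Y : V → (End V)[[z, z⁻¹]]`.  Here `Y u n` is the mode `uₙ`, so that `Y(u, z) = ∑ₙ uₙ z⁻ⁿ⁻¹`.
The equation for `r, m, n` is the coefficient of `z₀⁻ʳ⁻¹ z₁⁻ᵐ⁻¹ z₂⁻ⁿ⁻¹` in
`z₀⁻¹ δ((z₁ - z₂) / z₀) YM(u, z₁) YM(v, z₂) - z₀⁻¹ δ((z₂ - z₁) / (-z₀)) YM(v, z₂) YM(u, z₁)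
  = z₂⁻¹ δ((z₁ - z₀) / z₂) YM(Y(u, z₀) v, z₂)`, applied to `w`.
The sums are finite as soon as `Y` and `YM` satisfy the truncation condition, which is a
separate axiom wherever this predicate is used. -/
def JacobiIdentity {V : Type u} [AddCommGroup V] [Module ℂ V]
    {M : Type v} [AddCommGroup M] [Module ℂ M]
    (Y : V →ₗ[ℂ] (ℤ → Module.End ℂ V)) (YM : V →ₗ[ℂ] (ℤ → Module.End ℂ M)) : Prop :=
  ∀ (a b : V) (w : M) (r m n : ℤ),
    ∑ᶠ i : ℕ, ((-1 : ℂ) ^ i * ((Ring.choose r i : ℤ) : ℂ)) •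
        (YM a (r + m - i) (YM b (n + i) w) -
          ((-1 : ℂ) ^ r) • YM b (r + n - i) (YM a (m + i) w)) =
      ∑ᶠ i : ℕ, ((Ring.choose m i : ℤ) : ℂ) • YM (Y a (r + i) b) (m + n - i) w

/-- A vertex operator algebra structure `(V, Y, 𝟏, ω)` on a complex vector space `V`. -/
structure VertexOperatorAlgebra (V : Type u) [AddCommGroup V] [Module ℂ V] where
  /-- The state-field map; `Y u n` is the mode `uₙ`. -/
  Y : V →ₗ[ℂ] (ℤ → Module.End ℂ V)
  /-- The vacuum vector `𝟏`. -/
  vacuum : V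
  /-- The conformal vector `ω`; its mode `ω_{m+1}` is `L(m)`. -/
  conformal : V
  /-- The central charge (rank). -/
  centralCharge : ℂ
  /-- The homogeneous subspaces `Vₙ`. -/
  weight : ℤ → Submodule ℂ V
  weight_isInternal : DirectSum.IsInternal weight
  weight_finiteDimensional : ∀ n, FiniteDimensional ℂ (weight n)
  weight_boundedBelow : ∃ N : ℤ, ∀ n, n < N → weight n = ⊥
  truncation : ∀ a b : V, ∃ N : ℤ, ∀ n, N ≤ n → Y a n b = 0
  /-- `Y(𝟏, z) = id`. -/
  vacuum_mode : ∀ n : ℤ, Y vacuum n = if n = -1 then LinearMap.id else 0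
  /-- `Y(a, z) 𝟏` has no singular terms. -/
  creation_regular : ∀ (a : V) (n : ℤ), 0 ≤ n → Y a n vacuum = 0
  /-- The constant term of `Y(a, z) 𝟏` is `a`. -/
  creation : ∀ a : V, Y a (-1) vacuum = a
  jacobi : JacobiIdentity Y Y
  /-- `[L(m), L(n)] = (m - n) L(m + n) + (m³ - m) / 12 · δ_{m+n,0} · c`. -/
  virasoro : ∀ m n : ℤ,
    Y conformal (m + 1) * Y conformal (n + 1) - Y conformal (n + 1) * Y conformal (m + 1) =
      ((m : ℂ) - (n : ℂ)) • Y conformal (m + n + 1) +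
        (if m + n = 0 then ((m : ℂ) ^ 3 - (m : ℂ)) / 12 * centralCharge else 0) •
          (LinearMap.id : V →ₗ[ℂ] V)
  /-- `L(0)` acts on `Vₙ` as multiplication by `n`. -/
  weight_L0 : ∀ (n : ℤ) (a : V), a ∈ weight n → Y conformal 1 a = (n : ℂ) • a
  /-- `Y(L(-1) a, z) = d/dz Y(a, z)`. -/
  derivative : ∀ (a : V) (n : ℤ), Y (Y conformal 0 a) n = -(n : ℂ) • Y a (n - 1)

/-- A weak module for a vertex operator algebra, with underlying vector space `M`. -/
structure WeakModule {V : Type u} [AddCommGroup V] [Module ℂ V] (A : VertexOperatorAlgebra V)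
    (M : Type v) [AddCommGroup M] [Module ℂ M] where
  /-- The module map `Y_M`; `Y a n` is the mode `aₙ` acting on `M`. -/
  Y : V →ₗ[ℂ] (ℤ → Module.End ℂ M)
  truncation : ∀ (a : V) (w : M), ∃ N : ℤ, ∀ n, N ≤ n → Y a n w = 0
  /-- `Y_M(𝟏, z) = id`. -/
  vacuum_mode : ∀ n : ℤ, Y A.vacuum n = if n = -1 then LinearMap.id else 0
  jacobi : JacobiIdentity A.Y Y

namespace WeakModule

/-- The subspace `N` is a weak submodule: it is stable under all modes. -/
def IsWeakSubmodule {V : Type u} [AddCommGroup V] [Module ℂ V] {A : VertexOperatorAlgebra V}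
    {M : Type v} [AddCommGroup M] [Module ℂ M] (X : WeakModule A M)
    (N : Submodule ℂ M) : Prop :=
  ∀ (a : V) (n : ℤ), ∀ w ∈ N, X.Y a n w ∈ N

/-- The subspace `N` is an irreducible weak submodule: it is a nonzero weak submodule, and it
contains no weak submodules other than `0` and itself. -/
def IsIrreducibleSubmodule {V : Type u} [AddCommGroup V] [Module ℂ V]
    {A : VertexOperatorAlgebra V} {M : Type v} [AddCommGroup M] [Module ℂ M]
    (X : WeakModule A M) (N : Submodule ℂ M) : Prop :=
  X.IsWeakSubmodule N ∧ N ≠ ⊥ ∧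
    ∀ N' : Submodule ℂ M, X.IsWeakSubmodule N' → N' ≤ N → N' = ⊥ ∨ N' = N

/-- The weak module is irreducible: it is nonzero and its only weak submodules are `0` and the
whole module. -/
def IsIrreducible {V : Type u} [AddCommGroup V] [Module ℂ V]
    {A : VertexOperatorAlgebra V} {M : Type v} [AddCommGroup M] [Module ℂ M]
    (X : WeakModule A M) : Prop :=
  X.IsIrreducibleSubmodule ⊤

/-- The weak module is completely reducible: it is the (internal) direct sum of a set of
irreducible weak submodules. -/
def IsCompletelyReducible {V : Type u} [AddCommGroup V] [Module ℂ V]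
    {A : VertexOperatorAlgebra V} {M : Type v} [AddCommGroup M] [Module ℂ M]
    (X : WeakModule A M) : Prop :=
  ∃ S : Set (Submodule ℂ M),
    (∀ N ∈ S, X.IsIrreducibleSubmodule N) ∧ sSupIndep S ∧ sSup S = ⊤

/-- The weak module is `ℤ`-graded: `M = ⨁ᵢ M(i)` over `i ∈ ℤ`, with
`aᵣ M(m) ⊆ M(m + n - r - 1)` for `a ∈ Vₙ`. -/
def IsZGraded {V : Type u} [AddCommGroup V] [Module ℂ V]
    {A : VertexOperatorAlgebra V} {M : Type v} [AddCommGroup M] [Module ℂ M]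
    (X : WeakModule A M) : Prop :=
  ∃ gr : ℤ → Submodule ℂ M, DirectSum.IsInternal gr ∧
    ∀ r m n : ℤ, ∀ a ∈ A.weight n, ∀ w ∈ gr m, X.Y a r w ∈ gr (m + n - r - 1)

/-- The operator `L(n)` on a weak module, where `Y_M(ω, z) = ∑ₙ L(n) z⁻ⁿ⁻²`. -/
def L {V : Type u} [AddCommGroup V] [Module ℂ V]
    {A : VertexOperatorAlgebra V} {M : Type v} [AddCommGroup M] [Module ℂ M]
    (X : WeakModule A M) (n : ℤ) : Module.End ℂ M :=
  X.Y A.conformal (n + 1)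

end WeakModule

namespace VertexOperatorAlgebra

/-- A vertex operator algebra as a weak module over itself. -/
def adjointModule {V : Type u} [AddCommGroup V] [Module ℂ V] (A : VertexOperatorAlgebra V) :
    WeakModule A V where
  Y := A.Y
  truncation := A.truncation
  vacuum_mode := A.vacuum_mode
  jacobi := A.jacobi

/-- A vertex operator algebra is simple if it is irreducible as a module over itself. -/
def IsSimple {V : Type u} [AddCommGroup V] [Module ℂ V] (A : VertexOperatorAlgebra V) : Prop :=
  A.adjointModule.IsIrreducible

end VertexOperatorAlgebra

/-- The linear operator `f` acts semisimply on the complex vector space `M`: the space is the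
direct sum of the eigenspaces of `f`. -/
def ActsSemisimply {M : Type v} [AddCommGroup M] [Module ℂ M] (f : Module.End ℂ M) : Prop :=
  DirectSum.IsInternal (fun μ : ℂ => f.eigenspace μ)

/-!
Let `W` be an irreducible weak module. It suffices to find one eigenvector of `L(0)` in `W`, say
with eigenvalue `μ`: since `[L(0), aₙ] = (p - n - 1) aₙ` for `a` of weight `p`
(`WeakModule.L_zero_mode`), the eigenspaces for `μ + ℤ` span a nonzero weak submodule, which is `W`,
and they form a `ℤ`-grading of it.

The eigenvector comes from the loop module `W ⊗ ℂ[t, t⁻¹]` (`WeakModule.loopModule`), on which a mode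
`aₙ` with `a` of weight `p` acts as `aₙ ⊗ t^(p - n - 1)`. It is `ℤ`-graded by powers of `t`, hence
completely reducible by hypothesis. The maps `Ψⱼ : w tᵏ ↦ (L(0) - k)ʲ w` from the loop module to `W`
are homomorphisms (`WeakModule.loopEval_mode`). By complete reducibility the surjection `Ψ₀`
(evaluation at `t = 1`) has a section `s`. An irreducible weak module has countable dimension, so
by the Schur-Dixmier lemma (`WeakModule.IsIrreducible.exists_eq_smul`) each `Ψⱼ ∘ s` is a scalar
`cⱼ`, and `c₀ = 1`.

Fix `w ≠ 0` and write `s w = ∑ uᵢ tⁱ` with `i` in a finite set `I`. Then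
`∑ᵢ (L(0) - i)ʲ uᵢ = cⱼ w` for all `j`. Expanding `∏ᵢ (Y - (X - i)) = ∑ₙ eₙ(X) Yⁿ`, the polynomial
`∑ₙ cₙ eₙ(X)` in `L(0)` kills `w`; it is nonzero because `e₀` has degree `#I`, the other `eₙ` have
smaller degree, and `c₀ = 1`
(`Module.End.exists_aeval_apply_eq_zero_of_sum_pow`). As `ℂ` is algebraically closed, `L(0)` has an
eigenvector.
-/

/-! ### Operators on complex vector spaces of countable dimension -/

/-- A complex operator that satisfies a polynomial equation on one nonzero vector has an
eigenvector, without any finiteness assumption on the space. -/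
theorem Module.End.exists_eigenspace_ne_bot_of_aeval_apply_eq_zero
    {W : Type v} [AddCommGroup W] [Module ℂ W] (f : Module.End ℂ W) :
    ∀ (d : ℕ) (R : Polynomial ℂ), R.natDegree = d → R ≠ 0 → ∀ w : W, w ≠ 0 →
      Polynomial.aeval f R w = 0 → ∃ μ : ℂ, f.eigenspace μ ≠ ⊥ := by
  intro d
  induction d with
  | zero =>
    intro R hd hR w hw h
    rw [Polynomial.eq_C_of_natDegree_eq_zero hd] at h hR
    have hc : R.coeff 0 ≠ 0 := fun h0 => hR (by rw [h0, Polynomial.C_0])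
    rw [Polynomial.aeval_C, Module.algebraMap_end_apply] at h
    exact absurd h (smul_ne_zero hc hw)
  | succ d ih =>
    intro R hd hR w hw h
    obtain ⟨μ, hμ⟩ := IsAlgClosed.exists_root R (by
      rw [Polynomial.degree_eq_natDegree hR, hd]; exact_mod_cast Nat.succ_ne_zero d)
    obtain ⟨Q, hQ⟩ := Polynomial.dvd_iff_isRoot.mpr hμ
    have hQ0 : Q ≠ 0 := fun h0 => hR (by rw [hQ, h0, mul_zero])
    by_cases hw' : Polynomial.aeval f Q w = 0
    · refine ih Q ?_ hQ0 w hw hw'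
      have := congrArg Polynomial.natDegree hQ
      rw [Polynomial.natDegree_mul (Polynomial.X_sub_C_ne_zero μ) hQ0,
        Polynomial.natDegree_X_sub_C] at this
      omega
    · refine ⟨μ, (Submodule.ne_bot_iff _).mpr ⟨_, ?_, hw'⟩⟩
      rw [hQ, map_mul, Module.End.mul_apply] at h
      simpa [Module.End.mem_eigenspace_iff, sub_eq_zero] using h

/-- If `f` has no eigenvector, then the vectors `(f - a)⁻¹ w`, for `a ∈ ℂ`, are linearly
independent. -/
theorem Module.End.linearIndependent_of_sub_apply_eq
    {W : Type v} [AddCommGroup W] [Module ℂ W] (f : Module.End ℂ W)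
    (hf : ∀ μ : ℂ, f.eigenspace μ = ⊥) {w : W} (hw : w ≠ 0) (x : ℂ → W)
    (hx : ∀ a, f (x a) - a • x a = w) : LinearIndependent ℂ x := by
  classical
  rw [linearIndependent_iff']
  intro s c hc a ha
  set Q : Polynomial ℂ :=
    ∑ a ∈ s, Polynomial.C (c a) * ∏ b ∈ s.erase a, (Polynomial.X - Polynomial.C b) with hQ
  have hQw : Polynomial.aeval f Q w = 0 := by
    have h := congrArg
      (Polynomial.aeval f (∏ b ∈ s, (Polynomial.X - Polynomial.C b))) hc
    rw [map_sum, map_zero] at h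
    rw [hQ, map_sum, LinearMap.sum_apply, ← h]
    refine Finset.sum_congr rfl fun a ha => ?_
    rw [← Finset.prod_erase_mul _ _ ha, map_mul, Module.End.mul_apply, map_smul, map_mul,
      Module.End.mul_apply, Polynomial.aeval_C, Module.algebraMap_end_apply]
    simp [hx a]
  have hQ0 : Q = 0 := by
    by_contra hne
    obtain ⟨μ, hμ⟩ :=
      f.exists_eigenspace_ne_bot_of_aeval_apply_eq_zero _ Q rfl hne w hw hQw
    exact hμ (hf μ)
  have he := congrArg (Polynomial.eval a) hQ0
  rw [hQ, Polynomial.eval_finsetSum, Finset.sum_eq_single a] at he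
  · simp only [Polynomial.eval_mul, Polynomial.eval_C, Polynomial.eval_prod, Polynomial.eval_sub,
      Polynomial.eval_X, Polynomial.eval_zero, mul_eq_zero, Finset.prod_eq_zero_iff,
      Finset.mem_erase, sub_eq_zero] at he
    rcases he with he | ⟨b, ⟨hb, -⟩, hab⟩
    · exact he
    · exact absurd hab.symm hb
  · intro b _ hb
    rw [Polynomial.eval_mul, Polynomial.eval_prod,
      Finset.prod_eq_zero (Finset.mem_erase.mpr ⟨hb.symm, ha⟩) (by simp), mul_zero]
  · exact fun h => absurd ha h

/-- On a space spanned by a countable set, an operator all of whose translates `f - a` are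
surjective has an eigenvector: otherwise `ℂ` would index a linearly independent family. -/
theorem Module.End.exists_eigenspace_ne_bot_of_countable
    {W : Type v} [AddCommGroup W] [Module ℂ W] [Nontrivial W] {t : Set W} (ht : t.Countable)
    (hspan : Submodule.span ℂ t = ⊤) (f : Module.End ℂ W)
    (hsurj : ∀ (a : ℂ) (w : W), ∃ x, f x - a • x = w) : ∃ μ : ℂ, f.eigenspace μ ≠ ⊥ := by
  by_contra! hf
  obtain ⟨w, hw⟩ := exists_ne (0 : W)
  choose x hx using fun a => hsurj a w
  have hle := (f.linearIndependent_of_sub_apply_eq hf hw x hx).cardinal_lift_le_rank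
  have hr : Module.rank ℂ W ≤ Cardinal.aleph0 := by
    rw [← rank_top, ← hspan]
    exact (rank_span_le t).trans ht.le_aleph0
  have h := hle.trans (Cardinal.lift_le.mpr hr)
  rw [Cardinal.mk_complex, Cardinal.lift_continuum, Cardinal.lift_aleph0] at h
  exact absurd h (not_le.mpr Cardinal.aleph0_lt_continuum)

open Polynomial in
/-- The coefficients, as polynomials in `X`, of `∏ᵢ (Y - (X - i))`: the total degree is `#I`. -/
theorem Polynomial.natDegree_coeff_prod_le (I : Finset ℤ) (n : ℕ) :
    ((∏ i ∈ I, (X - C (X - C (i : ℂ))) : ℂ[X][X]).coeff n).natDegree ≤ I.card - n := by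
  classical
  induction I using Finset.induction_on generalizing n with
  | empty =>
    rw [Finset.prod_empty, coeff_one]
    split_ifs <;> simp
  | insert i I hi ih =>
    have hdeg : (∏ i ∈ I, (X - C (X - C (i : ℂ))) : ℂ[X][X]).natDegree = I.card := by
      rw [natDegree_prod_of_monic _ _ fun i _ => monic_X_sub_C _]
      simp only [natDegree_X_sub_C, Finset.sum_const, smul_eq_mul, mul_one]
    rw [Finset.prod_insert hi, Finset.card_insert_of_notMem hi, sub_mul, coeff_sub, coeff_C_mul]
    have h2 : ((X - C (i : ℂ)) *
        (∏ i ∈ I, (X - C (X - C (i : ℂ))) : ℂ[X][X]).coeff n).natDegree ≤ I.card + 1 - n := by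
      by_cases hn : n ≤ I.card
      · refine natDegree_mul_le.trans ?_
        have := ih n
        rw [natDegree_X_sub_C]
        omega
      · rw [coeff_eq_zero_of_natDegree_lt (by omega), mul_zero, natDegree_zero]
        omega
    refine (natDegree_sub_le _ _).trans (max_le ?_ h2)
    rcases n with _ | n
    · simp
    · rw [coeff_X_mul]
      exact (ih n).trans (by omega)

open Polynomial in
/-- If the power sums `∑ᵢ (L - i)ⁿ uᵢ` of finitely many vectors are all multiples `cₙ w` of one
vector `w`, and `c₀ = 1`, then `w` is annihilated by a nonzero polynomial in `L`. Writing
`∏ᵢ (Y - (X - i)) = ∑ₙ eₙ(X) Yⁿ`, the polynomial is `∑ₙ cₙ eₙ(X)`. -/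
theorem Module.End.exists_aeval_apply_eq_zero_of_sum_pow
    {W : Type v} [AddCommGroup W] [Module ℂ W] (L : Module.End ℂ W) (I : Finset ℤ) (u : ℤ → W)
    (w : W) (c : ℕ → ℂ) (hc0 : c 0 = 1)
    (hc : ∀ n, ∑ i ∈ I, ((L - algebraMap ℂ (Module.End ℂ W) (i : ℂ)) ^ n) (u i) = c n • w) :
    ∃ R : ℂ[X], R ≠ 0 ∧ aeval L R w = 0 := by
  set Q : ℂ[X][X] := ∏ i ∈ I, (X - C (X - C (i : ℂ))) with hQ
  have hQdeg : Q.natDegree = I.card := by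
    rw [hQ, natDegree_prod_of_monic _ _ fun i _ => monic_X_sub_C _]
    simp only [natDegree_X_sub_C, Finset.sum_const, smul_eq_mul, mul_one]
  refine ⟨∑ n ∈ Finset.range (I.card + 1), C (c n) * Q.coeff n, ?_, ?_⟩
  · -- The term `n = 0` is `∏ᵢ (i - X)`, of degree `#I`; the others have smaller degree.
    intro h0
    have hco := congrArg (fun p => p.coeff I.card) h0
    simp only [finsetSum_coeff, coeff_C_mul, coeff_zero] at hco
    rw [Finset.sum_range_succ', Finset.sum_eq_zero, zero_add, hc0, one_mul] at hco
    · have hQ0 : Q.coeff 0 = ∏ i ∈ I, -(X - C (i : ℂ)) := by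
        rw [hQ, coeff_zero_eq_eval_zero, eval_prod]
        simp
      rw [hQ0, Finset.prod_neg, ← C_1, ← C_neg, ← C_pow, coeff_C_mul] at hco
      have hm : (∏ i ∈ I, (X - C (i : ℂ))).Monic := monic_prod_of_monic _ _
        fun i _ => monic_X_sub_C _
      have hd : (∏ i ∈ I, (X - C (i : ℂ))).natDegree = I.card := by
        rw [natDegree_prod_of_monic _ _ fun i _ => monic_X_sub_C _]
        simp only [natDegree_X_sub_C, Finset.sum_const, smul_eq_mul, mul_one]
      have h1 : (∏ i ∈ I, (X - C (i : ℂ))).coeff I.card = 1 := by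
        rw [← hd]
        exact hm.coeff_natDegree
      rw [h1, mul_one] at hco
      exact absurd hco (pow_ne_zero _ (neg_ne_zero.mpr one_ne_zero))
    · intro n hn
      rw [Finset.mem_range] at hn
      rw [coeff_eq_zero_of_natDegree_lt
        ((natDegree_coeff_prod_le I (n + 1)).trans_lt (by omega)), mul_zero]
  · -- Substituting the power sums for `cₙ w` gives `∑ᵢ Q(L - i, L) uᵢ`, and `Q(X - i, X) = 0`.
    have key : ∀ i ∈ I, ∑ n ∈ Finset.range (I.card + 1),
        aeval L (Q.coeff n) (((L - algebraMap ℂ (Module.End ℂ W) (i : ℂ)) ^ n) (u i)) = 0 := by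
      intro i hi
      have he : Q.eval (X - C (i : ℂ)) = 0 := by
        rw [hQ, eval_prod]
        exact Finset.prod_eq_zero hi (by simp)
      rw [eval_eq_sum_range, hQdeg] at he
      have := congrArg (fun p => aeval L p (u i)) he
      simpa [map_sum, LinearMap.sum_apply] using this
    rw [map_sum, LinearMap.sum_apply]
    calc _ = ∑ n ∈ Finset.range (I.card + 1), ∑ i ∈ I,
          aeval L (Q.coeff n) (((L - algebraMap ℂ (Module.End ℂ W) (i : ℂ)) ^ n) (u i)) := by
          refine Finset.sum_congr rfl fun n _ => ?_
          rw [← map_sum, hc, map_smul, map_mul, aeval_C, Module.End.mul_apply,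
            Module.algebraMap_end_apply]
      _ = 0 := by
          rw [Finset.sum_comm]
          exact Finset.sum_eq_zero key

/-! ### Consequences of the Jacobi identity -/

/-- To prove an additive property of all vectors it suffices to treat homogeneous ones. -/
theorem VertexOperatorAlgebra.homogeneous_induction {V : Type u} [AddCommGroup V] [Module ℂ V]
    (A : VertexOperatorAlgebra V) {p : V → Prop} (hom : ∀ n, ∀ a ∈ A.weight n, p a)
    (add : ∀ a b, p a → p b → p (a + b)) (a : V) : p a := by
  have ha : a ∈ iSup A.weight := A.weight_isInternal.submodule_iSup_eq_top ▸ Submodule.mem_top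
  exact Submodule.iSup_induction A.weight (motive := p) ha hom
    (hom 0 0 (Submodule.zero_mem _)) add

namespace WeakModule

variable {V : Type u} [AddCommGroup V] [Module ℂ V] {A : VertexOperatorAlgebra V}
  {M : Type v} [AddCommGroup M] [Module ℂ M] (X : WeakModule A M)

/-- The commutator formula for `a₁`. -/
theorem commutator_mode_one (a b : V) (n : ℤ) (w : M) :
    X.Y a 1 (X.Y b n w) - X.Y b n (X.Y a 1 w) =
      X.Y (A.Y a 0 b) (n + 1) w + X.Y (A.Y a 1 b) n w := by
  have h := X.jacobi a b w 0 1 n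
  rw [finsum_eq_single _ 0 (fun i hi => by
      rw [Ring.choose_zero_pos ℤ (Nat.pos_of_ne_zero hi)]; simp),
    finsum_eq_sum_of_support_subset (s := Finset.range 2) _ ?_] at h
  · simpa [Finset.sum_range_succ, Ring.choose_one_right, add_comm] using h
  · intro i hi
    by_contra hni
    refine hi ?_
    have h2 : 1 < i := by simpa using hni
    have : Ring.choose (1 : ℤ) i = 0 := by
      have := Ring.choose_natCast (R := ℤ) 1 i
      rw [Nat.choose_eq_zero_of_lt h2] at this
      exact_mod_cast this
    simp [this]

theorem _root_.Ring.choose_neg_two (i : ℕ) :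
    Ring.choose (-2 : ℤ) i = (-1) ^ i * ((i : ℤ) + 1) := by
  have h := Ring.choose_neg' (2 : ℤ) i
  rw [Ring.multichoose_two, Units.smul_def, Int.coe_negOnePow_natCast, smul_eq_mul] at h
  exact h

/-- The mode form of `Y_M(a₋₂ 𝟏, z) = d/dz Y_M(a, z)`. -/
theorem mode_of_neg_two_vacuum (a : V) (n : ℤ) (w : M) :
    X.Y (A.Y a (-2) A.vacuum) n w = -(n : ℂ) • X.Y a (n - 1) w := by
  have h := X.jacobi a A.vacuum w (-2) 0 n
  have hsign : ∀ i : ℕ, (-1 : ℂ) ^ i * ((Ring.choose (-2 : ℤ) i : ℤ) : ℂ) = (i : ℂ) + 1 := by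
    intro i
    rw [Ring.choose_neg_two]
    push_cast
    rw [← mul_assoc, ← mul_pow, neg_one_mul, neg_neg, one_pow, one_mul]
  have hsq : ((-1 : ℂ) ^ (-2 : ℤ)) = 1 := by norm_num
  simp only [hsign, hsq, one_smul, X.vacuum_mode] at h
  rw [finsum_eq_single (fun i : ℕ => ((Ring.choose (0 : ℤ) i : ℤ) : ℂ) • _) 0 (fun i hi => by
      rw [Ring.choose_zero_pos ℤ (Nat.pos_of_ne_zero hi)]; simp)] at h
  simp only [Ring.choose_zero_right, Nat.cast_zero, zero_add, sub_zero, add_zero, Int.cast_one,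
    one_smul] at h
  rw [← h]
  -- Only one vacuum mode `𝟏₋₁` contributes: to the first product if `n < 0`, to the second if
  -- `n > 0`, and to neither if `n = 0`.
  rcases lt_trichotomy n 0 with hn | rfl | hn
  · obtain ⟨k, rfl⟩ : ∃ k : ℕ, n = -1 - k := ⟨(-1 - n).toNat, by omega⟩
    rw [finsum_eq_single _ k]
    · rw [if_pos (by ring), if_neg (by omega), show (-2 : ℤ) - k = -1 - k - 1 by ring]
      simp
    · intro i hi
      rw [if_neg (by omega), if_neg (by omega)]
      simp
  · rw [finsum_eq_zero_of_forall_eq_zero]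
    · simp
    · intro i
      rw [if_neg (by omega), if_neg (by omega)]
      simp
  · obtain ⟨k, rfl⟩ : ∃ k : ℕ, n = k + 1 := ⟨(n - 1).toNat, by omega⟩
    rw [finsum_eq_single _ k]
    · rw [if_neg (by omega), if_pos (by ring)]
      simp
      module
    · intro i hi
      rw [if_neg (by omega), if_neg (by omega)]
      simp

/-- `[L(0), bₙ] = (p - n - 1) bₙ` for `b` of weight `p`. -/
theorem L_zero_mode {p : ℤ} {b : V} (hb : b ∈ A.weight p) (n : ℤ) (w : M) :
    X.L 0 (X.Y b n w) = X.Y b n (X.L 0 w) + ((p - n - 1 : ℤ) : ℂ) • X.Y b n w := by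
  have hder : A.Y A.conformal 0 b = A.Y b (-2) A.vacuum := by
    have h := A.derivative b (-1)
    have h' := congrArg (fun f => f A.vacuum) h
    simpa [A.creation] using h'
  have h := X.commutator_mode_one A.conformal b n w
  rw [A.weight_L0 p b hb, hder, X.mode_of_neg_two_vacuum, sub_eq_iff_eq_add, map_smul] at h
  rw [L, zero_add, h, add_sub_cancel_right, Pi.smul_apply, LinearMap.smul_apply]
  push_cast
  module

/-- A homogeneous mode maps eigenspaces of `L(0)` to eigenspaces of `L(0)`. -/
theorem mode_mem_eigenspace {p : ℤ} {b : V} (hb : b ∈ A.weight p) (n : ℤ) {μ : ℂ} {w : M}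
    (hw : w ∈ (X.L 0).eigenspace μ) :
    X.Y b n w ∈ (X.L 0).eigenspace (μ + ((p - n - 1 : ℤ) : ℂ)) := by
  rw [Module.End.mem_eigenspace_iff] at hw ⊢
  rw [X.L_zero_mode hb, hw, map_smul, add_smul]

end WeakModule

namespace VertexOperatorAlgebra

variable {V : Type u} [AddCommGroup V] [Module ℂ V] (A : VertexOperatorAlgebra V)

theorem weight_eq_eigenspace (n : ℤ) :
    A.weight n = (A.adjointModule.L 0).eigenspace (n : ℂ) := by
  have hle : ∀ n, A.weight n ≤ (A.adjointModule.L 0).eigenspace (n : ℂ) := fun n a ha =>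
    Module.End.mem_eigenspace_iff.mpr (A.weight_L0 n a ha)
  refine le_antisymm (hle n) fun a ha => ?_
  have htop := A.weight_isInternal.submodule_iSup_eq_top
  rw [iSup_split_single A.weight n] at htop
  obtain ⟨x, hx, y, hy, rfl⟩ := Submodule.mem_sup.mp (htop ▸ Submodule.mem_top : a ∈ _)
  have hind := ((A.adjointModule.L 0).eigenspaces_iSupIndep.comp
    (Int.cast_injective (α := ℂ))) n
  have hy1 : y ∈ (A.adjointModule.L 0).eigenspace (n : ℂ) := by
    simpa using Submodule.sub_mem _ ha (hle n hx)
  have hy0 : y = 0 :=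
    Submodule.disjoint_def.mp hind y hy1 (iSup₂_mono (fun j _ => hle j) hy)
  rwa [hy0, add_zero]

theorem vacuum_mem_weight : A.vacuum ∈ A.weight 0 := by
  rw [weight_eq_eigenspace, Module.End.mem_eigenspace_iff]
  simpa [WeakModule.L, adjointModule] using A.creation_regular A.conformal 1 zero_le_one

theorem mode_mem_weight {p q : ℤ} {a b : V} (ha : a ∈ A.weight p) (hb : b ∈ A.weight q)
    (n : ℤ) : A.Y a n b ∈ A.weight (q + p - n - 1) := by
  rw [weight_eq_eigenspace] at hb ⊢
  have h := A.adjointModule.mode_mem_eigenspace ha n hb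
  rwa [← Int.cast_add, show q + (p - n - 1) = q + p - n - 1 by ring] at h

end VertexOperatorAlgebra

/-! ### The loop module -/

namespace WeakModule

section Jacobi

theorem _root_.finsum_eq_finsum_of_add {ι : Type*} {M : Type*} [AddCommMonoid M]
    {f f₁ f₂ g g₁ g₂ : ι → M} (hf₁ : f₁.HasFiniteSupport) (hf₂ : f₂.HasFiniteSupport)
    (hg₁ : g₁.HasFiniteSupport) (hg₂ : g₂.HasFiniteSupport) (hf : ∀ i, f i = f₁ i + f₂ i)
    (hg : ∀ i, g i = g₁ i + g₂ i) (h₁ : ∑ᶠ i, f₁ i = ∑ᶠ i, g₁ i)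
    (h₂ : ∑ᶠ i, f₂ i = ∑ᶠ i, g₂ i) : ∑ᶠ i, f i = ∑ᶠ i, g i := by
  rw [finsum_congr hf, finsum_congr hg, finsum_add_distrib hf₁ hf₂, finsum_add_distrib hg₁ hg₂,
    h₁, h₂]

variable {V : Type u} [AddCommGroup V] [Module ℂ V] {M : Type v} [AddCommGroup M] [Module ℂ M]

theorem finite_support_jacobi_left {YM : V →ₗ[ℂ] (ℤ → Module.End ℂ M)}
    (hYM : ∀ (a : V) (w : M), ∃ N : ℤ, ∀ n, N ≤ n → YM a n w = 0) (a b : V) (w : M)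
    (r m n : ℤ) (c : ℕ → ℂ) (d : ℂ) :
    (fun i : ℕ => c i • (YM a (r + m - i) (YM b (n + i) w) -
      d • YM b (r + n - i) (YM a (m + i) w))).HasFiniteSupport := by
  obtain ⟨N₁, h₁⟩ := hYM a w
  obtain ⟨N₂, h₂⟩ := hYM b w
  refine (Set.finite_Iio ((N₁ - m).toNat + (N₂ - n).toNat)).subset fun i hi => ?_
  by_contra hlt
  rw [Set.mem_Iio, not_lt] at hlt
  refine hi ?_
  simp only
  rw [h₁ (m + i) (by omega), h₂ (n + i) (by omega)]
  simp

theorem finite_support_jacobi_right {Y : V →ₗ[ℂ] (ℤ → Module.End ℂ V)}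
    (hY : ∀ a b : V, ∃ N : ℤ, ∀ n, N ≤ n → Y a n b = 0)
    (YM : V →ₗ[ℂ] (ℤ → Module.End ℂ M)) (a b : V) (w : M) (r m n : ℤ) (c : ℕ → ℂ) :
    (fun i : ℕ => c i • YM (Y a (r + i) b) (m + n - i) w).HasFiniteSupport := by
  obtain ⟨N, h⟩ := hY a b
  refine (Set.finite_Iio (N - r).toNat).subset fun i hi => ?_
  by_contra hlt
  rw [Set.mem_Iio, not_lt] at hlt
  refine hi ?_
  simp only
  rw [h (r + i) (by omega)]
  simp

end Jacobi

variable {V : Type u} [AddCommGroup V] [Module ℂ V] {A : VertexOperatorAlgebra V}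
  {W : Type v} [AddCommGroup W] [Module ℂ W] (X : WeakModule A W)

/-- The modes of the loop module `W ⊗ ℂ[t, t⁻¹]`, realised as `ℤ →₀ W` with `single k w` in the
role of `w tᵏ`: for `a` of weight `p`, the mode `aₙ` is `aₙ ⊗ t^(p - n - 1)`. -/
noncomputable def loopY : V →ₗ[ℂ] (ℤ → Module.End ℂ (ℤ →₀ W)) :=
  DirectSum.toModule ℂ ℤ _ (fun p =>
    (LinearMap.pi fun n =>
      { toFun := fun a => Finsupp.lsum ℂ fun k => Finsupp.lsingle (k + p - n - 1) ∘ₗ X.Y a n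
        map_add' := fun a b => by ext; simp
        map_smul' := fun c a => by ext; simp }) ∘ₗ (A.weight p).subtype) ∘ₗ
    (LinearEquiv.ofBijective (DirectSum.coeLinearMap A.weight) A.weight_isInternal).symm

theorem loopY_single {p : ℤ} {a : V} (ha : a ∈ A.weight p) (n k : ℤ) (w : W) :
    X.loopY a n (Finsupp.single k w) = Finsupp.single (k + p - n - 1) (X.Y a n w) := by
  have h : (LinearEquiv.ofBijective (DirectSum.coeLinearMap A.weight) A.weight_isInternal).symm a
      = DirectSum.lof ℂ ℤ (fun p => A.weight p) p ⟨a, ha⟩ := by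
    rw [LinearEquiv.symm_apply_eq]
    exact (DirectSum.coeLinearMap_lof A.weight p ⟨a, ha⟩).symm
  rw [loopY, LinearMap.comp_apply, LinearEquiv.coe_coe, h, DirectSum.toModule_lof]
  simp

theorem loopY_truncation (a : V) (x : ℤ →₀ W) : ∃ N : ℤ, ∀ n, N ≤ n → X.loopY a n x = 0 := by
  induction x using Finsupp.induction_linear with
  | zero => exact ⟨0, fun n _ => map_zero _⟩
  | add x y hx hy =>
    obtain ⟨N₁, h₁⟩ := hx
    obtain ⟨N₂, h₂⟩ := hy
    exact ⟨max N₁ N₂, fun n hn => by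
      rw [map_add, h₁ n (le_of_max_le_left hn), h₂ n (le_of_max_le_right hn), add_zero]⟩
  | single k w =>
    induction a using A.homogeneous_induction with
    | hom p a ha =>
      obtain ⟨N, h⟩ := X.truncation a w
      exact ⟨N, fun n hn => by rw [X.loopY_single ha, h n hn, Finsupp.single_zero]⟩
    | add a b ha hb =>
      obtain ⟨N₁, h₁⟩ := ha
      obtain ⟨N₂, h₂⟩ := hb
      exact ⟨max N₁ N₂, fun n hn => by
        rw [map_add, Pi.add_apply, LinearMap.add_apply, h₁ n (le_of_max_le_left hn),
          h₂ n (le_of_max_le_right hn), add_zero]⟩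

/-- For homogeneous `a`, `b` all terms of the identity lie in the same degree, where the identity
is the one in `W`; the general case follows by additivity. -/
theorem loopY_jacobi : JacobiIdentity A.Y X.loopY := by
  have hl := fun a b x r m n => finite_support_jacobi_left X.loopY_truncation a b x r m n
    (fun i => (-1 : ℂ) ^ i * ((Ring.choose r i : ℤ) : ℂ)) ((-1 : ℂ) ^ r)
  have hr := fun a b x r m n => finite_support_jacobi_right A.truncation X.loopY a b x r m n
    (fun i => ((Ring.choose m i : ℤ) : ℂ))
  intro a b x r m n
  induction x using Finsupp.induction_linear with
  | zero => simp
  | add x y hx hy =>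
    refine finsum_eq_finsum_of_add (hl a b x r m n) (hl a b y r m n) (hr a b x r m n)
      (hr a b y r m n) (fun i => ?_) (fun i => ?_) hx hy
    · simp only [map_add, smul_add, smul_sub]
      abel
    · simp only [map_add, smul_add]
  | single k w =>
    induction a using A.homogeneous_induction with
    | add a a' ha ha' =>
      refine finsum_eq_finsum_of_add (hl a b _ r m n) (hl a' b _ r m n) (hr a b _ r m n)
        (hr a' b _ r m n) (fun i => ?_) (fun i => ?_) ha ha'
      · simp only [map_add, Pi.add_apply, LinearMap.add_apply, smul_add, smul_sub]
        abel
      · simp only [map_add, Pi.add_apply, LinearMap.add_apply, smul_add]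
    | hom p a ha =>
      induction b using A.homogeneous_induction with
      | add b b' hb hb' =>
        refine finsum_eq_finsum_of_add (hl a b _ r m n) (hl a b' _ r m n) (hr a b _ r m n)
          (hr a b' _ r m n) (fun i => ?_) (fun i => ?_) hb hb'
        · simp only [map_add, Pi.add_apply, LinearMap.add_apply, smul_add, smul_sub]
          abel
        · simp only [map_add, Pi.add_apply, LinearMap.add_apply, smul_add]
      | hom q b hb =>
        have hinj := Finsupp.single_injective (M := W) (k + p + q - r - m - n - 2)
        have h := congrArg (Finsupp.lsingle (R := ℂ) (k + p + q - r - m - n - 2))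
          (X.jacobi a b w r m n)
        have hmap := fun f : ℕ → W => (Finsupp.lsingle (R := ℂ) (M := W)
          (k + p + q - r - m - n - 2)).toAddMonoidHom.map_finsum_of_injective hinj f
        simp only [LinearMap.toAddMonoidHom_coe] at hmap
        rw [hmap, hmap] at h
        refine Eq.trans (finsum_congr fun i => ?_) (h.trans (finsum_congr fun i => ?_))
        · rw [X.loopY_single hb, X.loopY_single ha, X.loopY_single ha, X.loopY_single hb, map_smul,
            map_sub, map_smul, Finsupp.lsingle_apply, Finsupp.lsingle_apply,
            show k + q - (n + i) - 1 + p - (r + m - i) - 1 = k + p + q - r - m - n - 2 by ring,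
            show k + p - (m + i) - 1 + q - (r + n - i) - 1 = k + p + q - r - m - n - 2 by ring]
        · rw [X.loopY_single (A.mode_mem_weight ha hb _), map_smul, Finsupp.lsingle_apply,
            show k + (q + p - (r + i) - 1) - (m + n - i) - 1 = k + p + q - r - m - n - 2 by ring]

/-- The loop module `W ⊗ ℂ[t, t⁻¹]` of a weak module `W`. -/
noncomputable def loopModule : WeakModule A (ℤ →₀ W) where
  Y := X.loopY
  truncation := X.loopY_truncation
  vacuum_mode n := by
    refine Finsupp.lhom_ext fun k w => ?_
    rw [X.loopY_single A.vacuum_mem_weight, X.vacuum_mode]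
    split_ifs with h
    · rw [h, LinearMap.id_apply, LinearMap.id_apply]
      congr 1
      ring
    · simp
  jacobi := X.loopY_jacobi

/-- The grading is by powers of `t`. -/
theorem loopModule_isZGraded : X.loopModule.IsZGraded := by
  refine ⟨fun k => LinearMap.range (Finsupp.lsingle k), ?_, ?_⟩
  · refine DirectSum.isInternal_submodule_of_iSupIndep_of_iSup_eq_top (fun k => ?_)
      Finsupp.iSup_lsingle_range
    refine Submodule.disjoint_def.mpr ?_
    rintro _ ⟨w, rfl⟩ hx
    have hle : ⨆ j, ⨆ (_ : j ≠ k), LinearMap.range (Finsupp.lsingle (R := ℂ) (M := W) j) ≤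
        LinearMap.ker (Finsupp.lapply k) := by
      refine iSup₂_le fun j hj => ?_
      rintro _ ⟨y, rfl⟩
      simp [hj]
    have h0 := hle hx
    simp at h0
    simp [h0]
  · rintro r m n a ha _ ⟨w, rfl⟩
    exact ⟨X.Y a r w, (X.loopY_single ha r m w).symm⟩

/-- The map `w tᵏ ↦ (L(0) - k)ʲ w` from the loop module to `W`; for `j = 0` it is the evaluation at
`t = 1`. -/
noncomputable def loopEval (j : ℕ) : (ℤ →₀ W) →ₗ[ℂ] W :=
  Finsupp.lsum ℂ fun k : ℤ => (X.L 0 - algebraMap ℂ (Module.End ℂ W) (k : ℂ)) ^ j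

theorem loopEval_single (j : ℕ) (k : ℤ) (w : W) : X.loopEval j (Finsupp.single k w) =
    ((X.L 0 - algebraMap ℂ (Module.End ℂ W) (k : ℂ)) ^ j) w := by
  simp [loopEval]

/-- Moving a mode of degree `d = p - n - 1` past `L(0)` shifts `L(0)` by `d`, which the degree
`k + d` of the result compensates. -/
theorem sub_pow_mode {p : ℤ} {a : V} (ha : a ∈ A.weight p) (n k : ℤ) (j : ℕ) (w : W) :
    ((X.L 0 - algebraMap ℂ (Module.End ℂ W) ((k + p - n - 1 : ℤ) : ℂ)) ^ j) (X.Y a n w) =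
      X.Y a n (((X.L 0 - algebraMap ℂ (Module.End ℂ W) (k : ℂ)) ^ j) w) := by
  induction j generalizing w with
  | zero => simp
  | succ j ih =>
    rw [pow_succ, pow_succ, Module.End.mul_apply, Module.End.mul_apply, ← ih]
    congr 1
    rw [LinearMap.sub_apply, LinearMap.sub_apply, X.L_zero_mode ha, map_sub,
      Module.algebraMap_end_apply, Module.algebraMap_end_apply, map_smul]
    push_cast
    module

/-- Each `loopEval j` is a homomorphism of weak modules. -/
theorem loopEval_mode (j : ℕ) (a : V) (n : ℤ) (x : ℤ →₀ W) :
    X.loopEval j (X.loopModule.Y a n x) = X.Y a n (X.loopEval j x) := by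
  change X.loopEval j (X.loopY a n x) = _
  induction a using A.homogeneous_induction with
  | add a b ha hb => simp only [map_add, Pi.add_apply, LinearMap.add_apply, ha, hb]
  | hom p a ha =>
    induction x using Finsupp.induction_linear with
    | zero => simp
    | add x y hx hy => simp only [map_add, hx, hy]
    | single k w =>
      rw [X.loopY_single ha, loopEval_single, loopEval_single, X.sub_pow_mode ha]

end WeakModule

/-! ### Homomorphisms, Schur's lemma and splitting -/

namespace WeakModule

variable {V : Type u} [AddCommGroup V] [Module ℂ V] {A : VertexOperatorAlgebra V}
  {M : Type v} [AddCommGroup M] [Module ℂ M] {W : Type v} [AddCommGroup W] [Module ℂ W]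

/-- A linear map between weak modules is a homomorphism if it commutes with all modes. -/
def IsHom (Z : WeakModule A M) (X : WeakModule A W) (f : M →ₗ[ℂ] W) : Prop :=
  ∀ (a : V) (n : ℤ) (x : M), f (Z.Y a n x) = X.Y a n (f x)

variable {Z : WeakModule A M} {X : WeakModule A W}

theorem IsHom.ker {f : M →ₗ[ℂ] W} (hf : IsHom Z X f) :
    Z.IsWeakSubmodule (LinearMap.ker f) := by
  intro a n x hx
  rw [LinearMap.mem_ker] at hx ⊢
  rw [hf, hx, map_zero]

theorem IsHom.map {f : M →ₗ[ℂ] W} (hf : IsHom Z X f) {N : Submodule ℂ M}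
    (hN : Z.IsWeakSubmodule N) : X.IsWeakSubmodule (N.map f) := by
  rintro a n _ ⟨x, hx, rfl⟩
  exact ⟨_, hN a n x hx, hf a n x⟩

theorem isWeakSubmodule_top : X.IsWeakSubmodule ⊤ := fun _ _ _ _ => Submodule.mem_top

theorem IsWeakSubmodule.inf {N N' : Submodule ℂ W} (hN : X.IsWeakSubmodule N)
    (hN' : X.IsWeakSubmodule N') : X.IsWeakSubmodule (N ⊓ N') :=
  fun a n w hw => ⟨hN a n w hw.1, hN' a n w hw.2⟩

theorem IsIrreducible.eq_top (hX : X.IsIrreducible) {N : Submodule ℂ W}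
    (hN : X.IsWeakSubmodule N) (hne : N ≠ ⊥) : N = ⊤ :=
  (hX.2.2 N hN le_top).resolve_left hne

theorem IsIrreducible.nontrivial (hX : X.IsIrreducible) : Nontrivial W :=
  (Submodule.nontrivial_iff ℂ).mp ⟨⟨_, _, hX.2.1⟩⟩

/-- A vertex operator algebra has countable dimension. -/
theorem _root_.VertexOperatorAlgebra.exists_countable_span_eq_top (A : VertexOperatorAlgebra V) :
    ∃ t : Set V, t.Countable ∧ Submodule.span ℂ t = ⊤ := by
  have h : ∀ n, ∃ s : Finset V, Submodule.span ℂ (s : Set V) = A.weight n := fun n =>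
    (Submodule.fg_iff_finiteDimensional _).mpr (A.weight_finiteDimensional n)
  choose s hs using h
  refine ⟨⋃ n, (s n : Set V), Set.countable_iUnion fun n => (s n).countable_toSet, ?_⟩
  rw [Submodule.span_iUnion, ← A.weight_isInternal.submodule_iSup_eq_top]
  exact iSup_congr hs

/-- An irreducible weak module has countable dimension: it is spanned by the vectors obtained from
any nonzero one by applying finitely many modes of vectors from a countable spanning set. -/
theorem IsIrreducible.exists_countable_span_eq_top (hX : X.IsIrreducible) :
    ∃ t : Set W, t.Countable ∧ Submodule.span ℂ t = ⊤ := by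
  obtain ⟨T, hT, hspan⟩ := A.exists_countable_span_eq_top
  have := hX.nontrivial
  obtain ⟨w₀, hw₀⟩ := exists_ne (0 : W)
  have : Countable T := hT
  let g : List (T × ℤ) → W := fun l => l.foldr (fun q w => X.Y q.1 q.2 w) w₀
  refine ⟨Set.range g, Set.countable_range g, hX.eq_top (fun a n w hw => ?_) ?_⟩
  · have ha : a ∈ Submodule.span ℂ T := hspan ▸ Submodule.mem_top
    induction hw using Submodule.span_induction with
    | zero => rw [map_zero]; exact Submodule.zero_mem _
    | add x y _ _ hx hy => rw [map_add]; exact Submodule.add_mem _ hx hy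
    | smul c x _ hx => rw [map_smul]; exact Submodule.smul_mem _ c hx
    | mem x hx =>
      obtain ⟨l, rfl⟩ := hx
      induction ha using Submodule.span_induction with
      | zero => rw [map_zero]; exact Submodule.zero_mem _
      | add a b _ _ ha hb => rw [map_add]; exact Submodule.add_mem _ ha hb
      | smul c a _ ha => rw [map_smul]; exact Submodule.smul_mem _ c ha
      | mem a ha => exact Submodule.subset_span ⟨(⟨a, ha⟩, n) :: l, rfl⟩
  · exact (Submodule.ne_bot_iff _).mpr ⟨w₀, Submodule.subset_span ⟨[], rfl⟩, hw₀⟩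

/-- Schur's lemma in the form of Dixmier: countable dimension replaces finite dimension. -/
theorem IsIrreducible.exists_eq_smul (hX : X.IsIrreducible) {f : Module.End ℂ W}
    (hf : IsHom X X f) : ∃ c : ℂ, ∀ w, f w = c • w := by
  have hsub : ∀ a : ℂ, IsHom X X (f - algebraMap ℂ (Module.End ℂ W) a) := fun a b n x => by
    simp [hf b n x]
  have := hX.nontrivial
  suffices h : ∃ μ : ℂ, f.eigenspace μ ≠ ⊥ by
    obtain ⟨μ, hμ⟩ := h
    have htop : f.eigenspace μ = ⊤ := by
      refine hX.eq_top (fun b n x hx => ?_) hμ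
      rw [Module.End.mem_eigenspace_iff] at hx ⊢
      rw [hf b n x, hx, map_smul]
    exact ⟨μ, fun w => Module.End.mem_eigenspace_iff.mp (htop ▸ Submodule.mem_top)⟩
  by_contra! hbot
  obtain ⟨t, ht, hspan⟩ := hX.exists_countable_span_eq_top
  obtain ⟨μ, hμ⟩ := f.exists_eigenspace_ne_bot_of_countable ht hspan fun a w => by
    have hne : (⊤ : Submodule ℂ W).map (f - algebraMap ℂ (Module.End ℂ W) a) ≠ ⊥ := by
      intro h0
      refine bot_ne_top ((hbot a).symm.trans ((Submodule.eq_top_iff').mpr fun x => ?_))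
      have hx : (f - algebraMap ℂ (Module.End ℂ W) a) x ∈ (⊥ : Submodule ℂ W) :=
        h0 ▸ Submodule.mem_map_of_mem Submodule.mem_top
      rw [Module.End.mem_eigenspace_iff]
      simpa [sub_eq_zero] using hx
    have htop := hX.eq_top ((hsub a).map isWeakSubmodule_top) hne
    obtain ⟨x, -, hx⟩ := htop.ge (Submodule.mem_top (x := w))
    exact ⟨x, by simpa using hx⟩
  exact hμ (hbot μ)

/-- A homomorphism from a completely reducible weak module onto an irreducible one splits: it
restricts to an isomorphism on any irreducible summand outside its kernel. -/
theorem IsCompletelyReducible.exists_section (hZ : Z.IsCompletelyReducible)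
    (hX : X.IsIrreducible) {f : M →ₗ[ℂ] W} (hf : IsHom Z X f) (hne : f ≠ 0) :
    ∃ s : W →ₗ[ℂ] M, IsHom X Z s ∧ ∀ w, f (s w) = w := by
  obtain ⟨S, hS, -, htop⟩ := hZ
  obtain ⟨N, hN, hNf⟩ : ∃ N ∈ S, ¬ N ≤ LinearMap.ker f := by
    by_contra! h
    exact hne (LinearMap.ker_eq_top.mp (top_le_iff.mp (htop ▸ sSup_le h)))
  obtain ⟨hNsub, -, hNirr⟩ := hS N hN
  have hinj : N ⊓ LinearMap.ker f = ⊥ :=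
    (hNirr _ (hNsub.inf hf.ker) inf_le_left).resolve_right fun h => hNf (inf_eq_left.mp h)
  have hsurj : N.map f = ⊤ :=
    hX.eq_top (hf.map hNsub) fun h => hNf (Submodule.map_le_iff_le_comap.mp h.le)
  let e : N ≃ₗ[ℂ] W := LinearEquiv.ofBijective (f.domRestrict N)
    ⟨by
      rw [← LinearMap.ker_eq_bot, LinearMap.ker_eq_bot']
      rintro ⟨x, hx⟩ h
      exact Subtype.ext ((Submodule.mem_bot ℂ).mp (hinj ▸ ⟨hx, h⟩)),
    fun w => by
      obtain ⟨x, hx, rfl⟩ := (hsurj ▸ Submodule.mem_top : w ∈ N.map f)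
      exact ⟨⟨x, hx⟩, rfl⟩⟩
  have he : ∀ x : N, e x = f x := fun x => rfl
  refine ⟨N.subtype ∘ₗ e.symm, fun a n w => ?_, fun w => ?_⟩
  · obtain ⟨x, rfl⟩ := e.surjective w
    have : X.Y a n (e x) = e ⟨Z.Y a n x, hNsub a n x x.2⟩ := by rw [he, he, hf]
    rw [this]
    simp
  · rw [LinearMap.comp_apply, Submodule.subtype_apply, ← he, LinearEquiv.coe_coe,
      e.apply_symm_apply]

/-! ### Semisimplicity of `L(0)` -/

/-- If the loop module of an irreducible weak module is completely reducible, then `L(0)` has an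
eigenvector: a section of the evaluation at `t = 1` gives a polynomial equation for `L(0)`. -/
theorem IsIrreducible.exists_eigenspace_ne_bot (hX : X.IsIrreducible)
    (hred : X.loopModule.IsCompletelyReducible) : ∃ μ : ℂ, (X.L 0).eigenspace μ ≠ ⊥ := by
  have := hX.nontrivial
  obtain ⟨w, hw⟩ := exists_ne (0 : W)
  have hhom : ∀ j, IsHom X.loopModule X (X.loopEval j) := fun j a n x => X.loopEval_mode j a n x
  obtain ⟨s, hs, hsec⟩ := hred.exists_section hX (hhom 0) fun h => hw (by
    simpa [loopEval_single] using congrArg (fun f => f (Finsupp.single 0 w)) h)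
  -- Each `loopEval j ∘ s` is an endomorphism of `W`, hence a scalar; as `s w` has finite support,
  -- this expresses multiples of `w` as power sums of the components of `s w`.
  have hscal : ∀ j, ∃ c : ℂ, ∀ w, (X.loopEval j ∘ₗ s) w = c • w := fun j =>
    hX.exists_eq_smul fun a n x => by
      rw [LinearMap.comp_apply, LinearMap.comp_apply, hs a n x, hhom j a n]
  choose c hc using hscal
  have hc0 : c 0 = 1 := by
    have h := hc 0 w
    rw [LinearMap.comp_apply, hsec] at h
    exact (smul_left_injective ℂ hw (by simpa using h)).symm
  obtain ⟨R, hR, hRw⟩ := (X.L 0).exists_aeval_apply_eq_zero_of_sum_pow (s w).support (s w) w c hc0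
    fun j => by
      rw [← hc j w, LinearMap.comp_apply, loopEval, Finsupp.lsum_apply, Finsupp.sum]
  exact (X.L 0).exists_eigenspace_ne_bot_of_aeval_apply_eq_zero _ R rfl hR w hw hRw

/-- If `L(0)` has an eigenvector for `μ`, then the eigenspaces for `μ + ℤ` span a nonzero weak
submodule. -/
theorem IsIrreducible.iSup_eigenspace_eq_top (hX : X.IsIrreducible) {μ : ℂ}
    (hμ : (X.L 0).eigenspace μ ≠ ⊥) : ⨆ n : ℤ, (X.L 0).eigenspace (μ + n) = ⊤ := by
  refine hX.eq_top (fun a n w hw => ?_) fun h => hμ ?_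
  · induction a using A.homogeneous_induction with
    | add a b ha hb =>
      rw [map_add, Pi.add_apply, LinearMap.add_apply]
      exact Submodule.add_mem _ ha hb
    | hom p a ha =>
      induction hw using Submodule.iSup_induction' with
      | zero => rw [map_zero]; exact Submodule.zero_mem _
      | add x y _ _ hx hy => rw [map_add]; exact Submodule.add_mem _ hx hy
      | mem k x hx =>
        refine Submodule.mem_iSup_of_mem (k + (p - n - 1)) ?_
        rw [Int.cast_add, ← add_assoc]
        exact X.mode_mem_eigenspace ha n hx
  · have h0 := iSup_eq_bot.mp h 0
    rwa [Int.cast_zero, add_zero] at h0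

end WeakModule

theorem mainTheorem3 {V : Type u} [AddCommGroup V] [Module ℂ V] (A : VertexOperatorAlgebra V)
    (hA : A.IsSimple)
    (hred : ∀ (M : Type v) [AddCommGroup M] [Module ℂ M] (X : WeakModule A M),
      X.IsZGraded → X.IsCompletelyReducible) :
    ∀ (W : Type v) [AddCommGroup W] [Module ℂ W] (X : WeakModule A W),
      X.IsIrreducible → ActsSemisimply (X.L 0) ∧ X.IsZGraded := by
  intro W _ _ X hX
  obtain ⟨μ, hμ⟩ := hX.exists_eigenspace_ne_bot
    (hred (ℤ →₀ W) X.loopModule X.loopModule_isZGraded)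
  have htop := hX.iSup_eigenspace_eq_top hμ
  refine ⟨?_, fun n => (X.L 0).eigenspace (μ + n), ?_, ?_⟩
  · exact DirectSum.isInternal_submodule_of_iSupIndep_of_iSup_eq_top
      (X.L 0).eigenspaces_iSupIndep
      (top_le_iff.mp (htop ▸ iSup_le fun n => le_iSup (fun ν => (X.L 0).eigenspace ν) (μ + n)))
  · exact DirectSum.isInternal_submodule_of_iSupIndep_of_iSup_eq_top
      ((X.L 0).eigenspaces_iSupIndep.comp
        ((add_right_injective μ).comp (Int.cast_injective (α := ℂ)))) htop
  · intro r m n a ha w hw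
    have h := X.mode_mem_eigenspace ha r hw
    rwa [add_assoc, ← Int.cast_add, show m + (n - r - 1) = m + n - r - 1 by ring] at h
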